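/- For $n \ge 1$ let $H_n = \sum_{k=1}^{n} \frac1k$ denote the $n$th harmonic number and let $\zeta$ denote the Riemann zeta function. Then the series below converges, and $$\sum_{n=1}^{\infty} H_{2n}\left(\zeta(2) - 1 - \frac{1}{2^2} - \cdots - \frac{1}{n^2} - \frac1n\right) = \log 2 - \frac78\,\zeta(3) - 1 .$$ -/

import Mathlib

open Filter Topology Finset

/-! Write `t n` for the bracket and `O n` for `oddHarmonic n`. Summation by parts turns the partial
sums into vanishing boundary terms, `-1`, `H (2N) - H N → log 2`, and `-1/2` times a partial sum of
`S = ∑ O n / n ^ 2`, so everything rests on `S = 7/4 ζ(3)`. That value comes from `T = ∑ 1 / (a b (a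
+ b))`, equal to `2 ζ(3)` by Euler. Split `T` by the parities of `a` and `b`: odd-odd gives `S / 2`,
each mixed class `S / 4`, even-even `T / 8`. Hence `S = 7/8 T`. -/

/-- The sum of the reciprocals of the first `n` odd numbers. -/
noncomputable def oddHarmonic (n : ℕ) : ℝ := ∑ i ∈ range n, 1 / (2 * (i : ℝ) + 1)

/-- The kernel `1 / (a b (a + b))` at `a = i + 1`, `b = j + 1`. -/
noncomputable def tornheim (p : ℕ × ℕ) : ℝ :=
  1 / (((p.1 : ℝ) + 1) * ((p.2 : ℝ) + 1) * ((p.1 : ℝ) + p.2 + 2))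

theorem oddHarmonic_succ (n : ℕ) :
    oddHarmonic (n + 1) = oddHarmonic n + 1 / (2 * (n : ℝ) + 1) := sum_range_succ ..

theorem harmonic_eq_sum_real (n : ℕ) : (harmonic n : ℝ) = ∑ i ∈ range n, 1 / ((i : ℝ) + 1) := by
  simp [harmonic]

theorem harmonic_succ_real (n : ℕ) :
    (harmonic (n + 1) : ℝ) = harmonic n + 1 / ((n : ℝ) + 1) := by
  simp [harmonic_succ]

theorem harmonic_nonneg_real (n : ℕ) : 0 ≤ (harmonic n : ℝ) := by
  rw [harmonic_eq_sum_real]; positivity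

theorem oddHarmonic_nonneg (n : ℕ) : 0 ≤ oddHarmonic n := by
  unfold oddHarmonic; positivity

theorem oddHarmonic_eq (n : ℕ) :
    oddHarmonic n = harmonic (2 * n) - (harmonic n : ℝ) / 2 := by
  induction n with
  | zero => simp [oddHarmonic]
  | succ n ih =>
    rw [oddHarmonic_succ, ih, show 2 * (n + 1) = 2 * n + 1 + 1 by ring, harmonic_succ_real,
      harmonic_succ_real, harmonic_succ_real]
    push_cast
    field_simp
    ring

/-! ### The double sum and its parity classes. -/

theorem summable_tornheim : Summable tornheim := by
  have h : Summable fun n : ℕ => 1 / (((n : ℝ) + 1) * √((n : ℝ) + 1)) := by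
    have := (summable_nat_add_iff 1).2 (Real.summable_one_div_nat_rpow.2 (by norm_num : (1:ℝ) < 3/2))
    refine this.congr fun n => ?_
    have hn : (0:ℝ) < (n:ℝ) + 1 := by positivity
    rw [Real.sqrt_eq_rpow, show (3/2:ℝ) = 1 + 1/2 by norm_num]
    push_cast
    rw [Real.rpow_add hn, Real.rpow_one]
  refine Summable.of_nonneg_of_le (fun p => by unfold tornheim; positivity) (fun p => ?_)
    (h.mul_of_nonneg h (fun _ => by positivity) (fun _ => by positivity))
  rw [tornheim, div_mul_div_comm, one_mul]
  refine one_div_le_one_div_of_le (by positivity) ?_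
  have ha : (0:ℝ) ≤ (p.1:ℝ) + 1 := by positivity
  have hb : (0:ℝ) ≤ (p.2:ℝ) + 1 := by positivity
  -- AM-GM bounds the kernel by the product `(a b) ^ (-3/2)`.
  have h1 : √((p.1:ℝ)+1) * √((p.2:ℝ)+1) ≤ (p.1:ℝ) + p.2 + 2 := by
    nlinarith [sq_nonneg (√((p.1:ℝ)+1) - √((p.2:ℝ)+1)), Real.sq_sqrt ha, Real.sq_sqrt hb]
  calc _ = ((p.1:ℝ) + 1) * ((p.2:ℝ) + 1) * (√((p.1:ℝ)+1) * √((p.2:ℝ)+1)) := by ring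
    _ ≤ _ := by gcongr

/-- Telescoping: a partial sum is the first `m` values minus a window of `m` values that moves off
to infinity. -/
theorem hasSum_sub_shift {u : ℕ → ℝ} (hu : Tendsto u atTop (𝓝 0)) (ha : Antitone u) (m : ℕ) :
    HasSum (fun i => u i - u (i + m)) (∑ i ∈ range m, u i) := by
  rw [hasSum_iff_tendsto_nat_of_nonneg (fun i => sub_nonneg.2 (ha (Nat.le_add_right i m)))]
  have key : ∀ N, ∑ i ∈ range N, (u i - u (i + m)) =
      ∑ i ∈ range m, u i - ∑ i ∈ range m, u (i + N) := by
    intro N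
    have h1 := sum_range_add u N m
    have h2 := sum_range_add u m N
    rw [add_comm m N, h1] at h2
    simp only [sum_sub_distrib, add_comm _ m, add_comm _ N]
    linarith
  simp only [key]
  have : Tendsto (fun N => ∑ i ∈ range m, u (i + N)) atTop (𝓝 (∑ i ∈ range m, 0)) :=
    tendsto_finsetSum _ fun i _ => by
      simpa only [add_comm i] using (tendsto_add_atTop_iff_nat i).2 hu
  simpa using tendsto_const_nhds.sub this

theorem hasSum_sum_antidiagonal {f : ℕ × ℕ → ℝ} (hf : Summable f) :
    HasSum (fun n => ∑ p ∈ antidiagonal n, f p) (∑' p, f p) := by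
  have h := (Finset.HasAntidiagonal.sigmaAntidiagonalEquivProd (A := ℕ)).hasSum_iff.2 hf.hasSum
  refine h.sigma fun n => ?_
  have := hasSum_fintype (fun c : antidiagonal n => f c)
  rwa [Finset.sum_coe_sort (antidiagonal n) f] at this

theorem tsum_prod_eq_parity {f : ℕ × ℕ → ℝ} (hf : Summable f) :
    ∑' p, f p = ∑' p : ℕ × ℕ, f (2 * p.1, 2 * p.2) + ∑' p : ℕ × ℕ, f (2 * p.1, 2 * p.2 + 1) +
      (∑' p : ℕ × ℕ, f (2 * p.1 + 1, 2 * p.2) + ∑' p : ℕ × ℕ, f (2 * p.1 + 1, 2 * p.2 + 1)) := by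
  have i0 : Function.Injective fun n : ℕ => 2 * n := fun a b h => by simpa using h
  have i1 : Function.Injective fun n : ℕ => 2 * n + 1 := fun a b h => by simpa using h
  have s00 : Summable fun p : ℕ × ℕ => f (2 * p.1, 2 * p.2) := hf.comp_injective (i0.prodMap i0)
  have s01 : Summable fun p : ℕ × ℕ => f (2 * p.1, 2 * p.2 + 1) :=
    hf.comp_injective (i0.prodMap i1)
  have s10 : Summable fun p : ℕ × ℕ => f (2 * p.1 + 1, 2 * p.2) :=
    hf.comp_injective (i1.prodMap i0)
  have s11 : Summable fun p : ℕ × ℕ => f (2 * p.1 + 1, 2 * p.2 + 1) :=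
    hf.comp_injective (i1.prodMap i1)
  have row (i : ℕ) : ∑' j, f (i, j) = ∑' j, f (i, 2 * j) + ∑' j, f (i, 2 * j + 1) :=
    (tsum_even_add_odd (f := fun j => f (i, j)) ((hf.prod_factor i).comp_injective i0)
      ((hf.prod_factor i).comp_injective i1)).symm
  have col : ∑' i, ∑' j, f (i, j) = ∑' i, ∑' j, f (2 * i, j) + ∑' i, ∑' j, f (2 * i + 1, j) :=
    (tsum_even_add_odd (f := fun i => ∑' j, f (i, j)) (hf.prod.comp_injective i0)
      (hf.prod.comp_injective i1)).symm
  rw [s00.tsum_prod, s01.tsum_prod, s10.tsum_prod, s11.tsum_prod, ← s00.prod.tsum_add s01.prod,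
    ← s10.prod.tsum_add s11.prod, hf.tsum_prod, col]
  simp only [row]

theorem hasSum_tornheim_row :
    HasSum (fun j : ℕ => (harmonic (j + 1) : ℝ) / ((j : ℝ) + 1) ^ 2) (∑' p, tornheim p) := by
  refine summable_tornheim.hasSum.prod_fiberwise fun j => ?_
  have hu : Tendsto (fun n : ℕ => 1 / ((n : ℝ) + 1)) atTop (𝓝 0) :=
    tendsto_one_div_add_atTop_nhds_zero_nat
  have ha : Antitone fun n : ℕ => 1 / ((n : ℝ) + 1) := fun a b h => by
    dsimp only; gcongr
  have := (hasSum_sub_shift hu ha (j + 1)).mul_left (1 / ((j : ℝ) + 1) ^ 2)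
  rw [← harmonic_eq_sum_real, one_div_mul_eq_div] at this
  refine this.congr_fun fun i => ?_
  unfold tornheim
  push_cast
  field_simp
  ring

/-- Euler's evaluation of the full double sum. -/
theorem tsum_tornheim {z : ℝ} (hz : HasSum (fun n : ℕ => 1 / ((n : ℝ) + 1) ^ 3) z) :
    ∑' p, tornheim p = 2 * z := by
  -- Rows give `T = ∑ H n / n ^ 2`; the diagonals `a + b = n` give `T = 2 ∑ H (n - 1) / n ^ 2 = 2 (T
  -- - z)`.
  have h1 := hasSum_tornheim_row.sub hz
  have h2 : HasSum (fun n : ℕ => 2 * ((harmonic (n + 1) : ℝ) / ((n : ℝ) + 2) ^ 2))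
      (∑' p, tornheim p) := by
    convert hasSum_sum_antidiagonal summable_tornheim using 2 with n
    have : ∀ p ∈ antidiagonal n, tornheim p =
        (1 / ((p.1 : ℝ) + 1) + 1 / ((p.2 : ℝ) + 1)) / ((n : ℝ) + 2) ^ 2 := by
      intro p hp
      rw [HasAntidiagonal.mem_antidiagonal] at hp
      subst hp
      unfold tornheim
      push_cast
      field_simp
      ring
    rw [sum_congr rfl this, ← sum_div, sum_add_distrib,
      Nat.sum_antidiagonal_eq_sum_range_succ (fun i _ => 1 / ((i : ℝ) + 1)),
      Nat.sum_antidiagonal_eq_sum_range_succ_mk, ← harmonic_eq_sum_real]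
    have := sum_range_reflect (fun i : ℕ => 1 / ((i : ℝ) + 1)) (n + 1)
    rw [← harmonic_eq_sum_real] at this
    simp only [Nat.add_sub_cancel] at this
    rw [this]
    ring
  have h3 : HasSum (fun n : ℕ => (harmonic n : ℝ) / ((n : ℝ) + 1) ^ 2) (∑' p, tornheim p - z) := by
    refine h1.congr_fun fun n => ?_
    rw [harmonic_succ_real]
    field_simp
    ring
  -- The dropped term is zero because `H 0 = 0`.
  have h4 := ((hasSum_nat_add_iff' 1).2 h3).mul_left 2
  have h5 := h4.unique (h2.congr_fun fun n => by
    push_cast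
    rw [add_assoc, one_add_one_eq_two])
  simp at h5
  linarith

/-- Even indices mean odd `a` and `b`; on the diagonal `a + b = 2 (n + 1)` use `1 / (a b) = (1 / a +
1 / b) / (a + b)`. -/
theorem hasSum_tornheim_even_even :
    HasSum (fun n : ℕ => oddHarmonic (n + 1) / ((n : ℝ) + 1) ^ 2)
      (2 * ∑' p : ℕ × ℕ, tornheim (2 * p.1, 2 * p.2)) := by
  have i0 : Function.Injective fun n : ℕ => 2 * n := fun a b h => by simpa using h
  have hs : Summable fun p : ℕ × ℕ => tornheim (2 * p.1, 2 * p.2) :=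
    summable_tornheim.comp_injective (i0.prodMap i0)
  refine ((hasSum_sum_antidiagonal hs).mul_left 2).congr_fun fun n => ?_
  have : ∀ p ∈ antidiagonal n, tornheim (2 * p.1, 2 * p.2) =
      (1 / (2 * (p.1 : ℝ) + 1) + 1 / (2 * (p.2 : ℝ) + 1)) / (2 * (n : ℝ) + 2) ^ 2 := by
    intro p hp
    rw [HasAntidiagonal.mem_antidiagonal] at hp
    subst hp
    unfold tornheim
    push_cast
    field_simp
    ring
  rw [sum_congr rfl this, ← sum_div, sum_add_distrib,
    Nat.sum_antidiagonal_eq_sum_range_succ (fun i _ => 1 / (2 * (i : ℝ) + 1)),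
    Nat.sum_antidiagonal_eq_sum_range_succ_mk]
  have := sum_range_reflect (fun i : ℕ => 1 / (2 * (i : ℝ) + 1)) (n + 1)
  simp only [Nat.add_sub_cancel] at this
  rw [this, ← oddHarmonic]
  field_simp
  ring

/-- Fixing the even `a = 2 (i + 1)`, the sum over odd `b` telescopes with shift `i + 1`. -/
theorem hasSum_tornheim_odd_even :
    HasSum (fun n : ℕ => oddHarmonic (n + 1) / ((n : ℝ) + 1) ^ 2)
      (4 * ∑' p : ℕ × ℕ, tornheim (2 * p.1 + 1, 2 * p.2)) := by
  have i0 : Function.Injective fun n : ℕ => 2 * n := fun a b h => by simpa using h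
  have i1 : Function.Injective fun n : ℕ => 2 * n + 1 := fun a b h => by simpa using h
  have hs : Summable fun p : ℕ × ℕ => tornheim (2 * p.1 + 1, 2 * p.2) :=
    summable_tornheim.comp_injective (i1.prodMap i0)
  refine (hs.hasSum.mul_left 4).prod_fiberwise fun i => ?_
  have hu : Tendsto (fun n : ℕ => 1 / (2 * (n : ℝ) + 1)) atTop (𝓝 0) := by
    have := (tendsto_one_div_add_atTop_nhds_zero_nat (𝕜 := ℝ)).comp
      (tendsto_id.const_mul_atTop' (zero_lt_two (α := ℕ)))
    refine this.congr fun n => ?_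
    simp
  have ha : Antitone fun n : ℕ => 1 / (2 * (n : ℝ) + 1) := fun a b h => by
    dsimp only; gcongr
  have := (hasSum_sub_shift hu ha (i + 1)).mul_left (1 / ((i : ℝ) + 1) ^ 2)
  rw [← oddHarmonic, one_div_mul_eq_div] at this
  refine this.congr_fun fun j => ?_
  unfold tornheim
  push_cast
  field_simp
  ring

theorem hasSum_oddHarmonic_div_sq {z : ℝ} (hz : HasSum (fun n : ℕ => 1 / ((n : ℝ) + 1) ^ 3) z) :
    HasSum (fun n : ℕ => oddHarmonic (n + 1) / ((n : ℝ) + 1) ^ 2) (7 / 4 * z) := by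
  have h1 := hasSum_tornheim_even_even.unique hasSum_tornheim_odd_even
  have h2 := tsum_prod_eq_parity summable_tornheim
  have h3 : ∑' p : ℕ × ℕ, tornheim (2 * p.1, 2 * p.2 + 1) =
      ∑' p : ℕ × ℕ, tornheim (2 * p.1 + 1, 2 * p.2) := by
    rw [← (Equiv.prodComm ℕ ℕ).tsum_eq]
    refine tsum_congr fun p => ?_
    simp only [tornheim, Equiv.prodComm_apply, Prod.fst_swap, Prod.snd_swap]
    push_cast
    ring
  -- Both `a` and `b` are even here, and the kernel is homogeneous of degree `-3`.
  have h4 : ∑' p : ℕ × ℕ, tornheim (2 * p.1 + 1, 2 * p.2 + 1) = 1 / 8 * ∑' p, tornheim p := by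
    rw [← tsum_mul_left]
    refine tsum_congr fun p => ?_
    unfold tornheim
    push_cast
    field_simp
    ring
  rw [h3, h4, tsum_tornheim hz] at h2
  convert hasSum_tornheim_even_even using 1
  linarith

/-! ### Summation by parts. -/

/-- The remainder of the series `∑ 1 / k ^ 2` after `m + 1` terms, less `1 / (m + 1)`. -/
noncomputable def zetaTwoDefect (q : ℝ) (m : ℕ) : ℝ :=
  q - ∑ k ∈ range (m + 1), 1 / ((k : ℝ) + 1) ^ 2 - 1 / ((m : ℝ) + 1)

theorem zetaTwoDefect_succ (q : ℝ) (m : ℕ) :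
    zetaTwoDefect q (m + 1) = zetaTwoDefect q m + 1 / (((m : ℝ) + 1) * ((m : ℝ) + 2) ^ 2) := by
  rw [zetaTwoDefect, sum_range_succ, zetaTwoDefect]
  push_cast
  field_simp
  ring

/-- The factor of `zetaTwoDefect q N` on the right is `∑ H (2n)` over `1 ≤ n ≤ N`; the other terms
come from summing it against the increments of the defect. -/
theorem sum_harmonic_mul_zetaTwoDefect (q : ℝ) (N : ℕ) :
    ∑ m ∈ range N, (harmonic (2 * (m + 1)) : ℝ) * zetaTwoDefect q m =
      (((N : ℝ) + 1) * harmonic (2 * N) - N - oddHarmonic N / 2) * zetaTwoDefect q N - 1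
        + (harmonic (2 * N) - harmonic N)
        - (∑ n ∈ range N, oddHarmonic (n + 1) / ((n : ℝ) + 1) ^ 2) / 2
        + harmonic (2 * N) / ((N : ℝ) + 1) + 1 / ((N : ℝ) + 1) ^ 2
        - oddHarmonic N / (2 * ((N : ℝ) + 1)) - oddHarmonic N / (2 * ((N : ℝ) + 1) ^ 2) := by
  induction N with
  | zero => simp [oddHarmonic]
  | succ N ih =>
    have h2 : (harmonic (2 * (N + 1)) : ℝ) =
        harmonic (2 * N) + 1 / (2 * (N : ℝ) + 1) + 1 / (2 * (N : ℝ) + 2) := by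
      rw [show 2 * (N + 1) = 2 * N + 1 + 1 by ring, harmonic_succ_real, harmonic_succ_real]
      push_cast
      ring
    rw [sum_range_succ, sum_range_succ, ih, zetaTwoDefect_succ, h2, oddHarmonic_succ,
      harmonic_succ_real]
    generalize ∑ n ∈ range N, oddHarmonic (n + 1) / ((n : ℝ) + 1) ^ 2 = E
    generalize zetaTwoDefect q N = t
    generalize oddHarmonic N = o
    generalize (harmonic (2 * N) : ℝ) = h
    generalize (harmonic N : ℝ) = h'
    push_cast
    field_simp
    ring

/-! ### Limits of the boundary terms. -/

theorem tendsto_zetaTwoDefect {q : ℝ} (hq : HasSum (fun n : ℕ => 1 / ((n : ℝ) + 1) ^ 2) q) :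
    Tendsto (zetaTwoDefect q) atTop (𝓝 0) := by
  have h1 := (tendsto_add_atTop_iff_nat 1).2 hq.tendsto_sum_nat
  have := (h1.const_sub q).sub (tendsto_one_div_add_atTop_nhds_zero_nat (𝕜 := ℝ))
  rwa [sub_self, sub_zero] at this

theorem zetaTwoDefect_nonpos {q : ℝ} (hq : HasSum (fun n : ℕ => 1 / ((n : ℝ) + 1) ^ 2) q)
    (m : ℕ) : zetaTwoDefect q m ≤ 0 := by
  refine Monotone.ge_of_tendsto (monotone_nat_of_le_succ fun n => ?_) (tendsto_zetaTwoDefect hq) m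
  rw [zetaTwoDefect_succ]
  exact le_add_of_nonneg_right (by positivity)

/-- Adding `1 / (m + 1) ^ 2` makes the defect decrease to `0`. This quadratic bound beats the `N log
N` growth of its factor in the boundary term. -/
theorem neg_one_div_sq_le_zetaTwoDefect {q : ℝ}
    (hq : HasSum (fun n : ℕ => 1 / ((n : ℝ) + 1) ^ 2) q) (m : ℕ) :
    -(1 / ((m : ℝ) + 1) ^ 2) ≤ zetaTwoDefect q m := by
  have hlim : Tendsto (fun n : ℕ => zetaTwoDefect q n + 1 / ((n : ℝ) + 1) ^ 2) atTop (𝓝 0) := by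
    have := (tendsto_zetaTwoDefect hq).add
      ((tendsto_one_div_add_atTop_nhds_zero_nat (𝕜 := ℝ)).pow 2)
    simpa using this
  have hanti : Antitone fun n : ℕ => zetaTwoDefect q n + 1 / ((n : ℝ) + 1) ^ 2 := by
    refine antitone_nat_of_succ_le fun n => ?_
    rw [zetaTwoDefect_succ, ← sub_nonneg]
    have : zetaTwoDefect q n + 1 / ((n : ℝ) + 1) ^ 2 - (zetaTwoDefect q n +
        1 / (((n : ℝ) + 1) * ((n : ℝ) + 2) ^ 2) + 1 / (((n + 1 : ℕ) : ℝ) + 1) ^ 2) =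
        1 / (((n : ℝ) + 1) ^ 2 * ((n : ℝ) + 2)) := by
      push_cast
      field_simp
      ring
    rw [this]
    positivity
  have := hanti.le_of_tendsto hlim m
  linarith

theorem tendsto_harmonic_div :
    Tendsto (fun n : ℕ => (harmonic n : ℝ) / n) atTop (𝓝 0) := by
  refine (tendsto_one_div_add_atTop_nhds_zero_nat (𝕜 := ℝ)).cesaro.congr fun n => ?_
  rw [harmonic_eq_sum_real, inv_mul_eq_div]

theorem tendsto_harmonic_two_mul_div :
    Tendsto (fun n : ℕ => (harmonic (2 * n) : ℝ) / ((n : ℝ) + 1)) atTop (𝓝 0) := by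
  have h := (tendsto_harmonic_div.comp
    (tendsto_id.const_mul_atTop' (zero_lt_two (α := ℕ)))).const_mul 2
  rw [mul_zero] at h
  refine squeeze_zero' (.of_forall fun n => div_nonneg (harmonic_nonneg_real _) (by positivity))
    ((eventually_gt_atTop 0).mono fun n hn => ?_) h
  have hn' : (0 : ℝ) < n := by exact_mod_cast hn
  have h0 := harmonic_nonneg_real (2 * n)
  calc (harmonic (2 * n) : ℝ) / ((n : ℝ) + 1) ≤ harmonic (2 * n) / n := by gcongr; linarith
    _ = _ := by
      simp only [Function.comp_apply, id]
      push_cast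
      field_simp

theorem oddHarmonic_le (n : ℕ) : oddHarmonic n ≤ harmonic (2 * n) := by
  rw [oddHarmonic_eq]
  linarith [harmonic_nonneg_real n]

theorem tendsto_oddHarmonic_div :
    Tendsto (fun n : ℕ => oddHarmonic n / ((n : ℝ) + 1)) atTop (𝓝 0) :=
  squeeze_zero (fun n => div_nonneg (oddHarmonic_nonneg n) (by positivity))
    (fun n => by gcongr; exact oddHarmonic_le n) tendsto_harmonic_two_mul_div

theorem tendsto_harmonic_two_mul_sub :
    Tendsto (fun n : ℕ => (harmonic (2 * n) : ℝ) - harmonic n) atTop (𝓝 (Real.log 2)) := by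
  have h := Real.tendsto_harmonic_sub_log
  have h2 := ((h.comp (tendsto_id.const_mul_atTop' (zero_lt_two (α := ℕ)))).sub h).add_const
    (Real.log 2)
  rw [sub_self, zero_add] at h2
  refine h2.congr' ((eventually_gt_atTop 0).mono fun n hn => ?_)
  have hn' : (n : ℝ) ≠ 0 := by exact_mod_cast hn.ne'
  simp only [Function.comp_apply, id]
  push_cast
  rw [Real.log_mul two_ne_zero hn']
  ring

theorem tendsto_mul_zetaTwoDefect {q : ℝ} (hq : HasSum (fun n : ℕ => 1 / ((n : ℝ) + 1) ^ 2) q) :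
    Tendsto (fun N : ℕ => (((N : ℝ) + 1) * harmonic (2 * N) - N - oddHarmonic N / 2) *
      zetaTwoDefect q N) atTop (𝓝 0) := by
  have hv : Tendsto (fun n : ℕ => 1 / ((n : ℝ) + 1)) atTop (𝓝 0) :=
    tendsto_one_div_add_atTop_nhds_zero_nat
  have hmaj := (tendsto_harmonic_two_mul_div.add hv).add (tendsto_oddHarmonic_div)
  simp only [add_zero] at hmaj
  refine squeeze_zero_norm (fun N => ?_) hmaj
  have h0 := harmonic_nonneg_real (2 * N)
  have h1 := oddHarmonic_nonneg N
  have hN : (0 : ℝ) < (N : ℝ) + 1 := by positivity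
  rw [norm_mul, Real.norm_eq_abs, Real.norm_eq_abs]
  have ht : |zetaTwoDefect q N| ≤ 1 / ((N : ℝ) + 1) ^ 2 := by
    rw [abs_of_nonpos (zetaTwoDefect_nonpos hq N)]
    linarith [neg_one_div_sq_le_zetaTwoDefect hq N]
  have hS : |((N : ℝ) + 1) * harmonic (2 * N) - N - oddHarmonic N / 2| ≤
      ((N : ℝ) + 1) * (harmonic (2 * N) + 1 + oddHarmonic N) := by
    have := mul_nonneg hN.le h0
    have := mul_nonneg (Nat.cast_nonneg (α := ℝ) N) h1
    rw [abs_le]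
    constructor <;> nlinarith
  calc _ ≤ ((N : ℝ) + 1) * (harmonic (2 * N) + 1 + oddHarmonic N) * (1 / ((N : ℝ) + 1) ^ 2) := by
        gcongr
    _ = _ := by field_simp

theorem hasSum_harmonic_mul_zetaTwoDefect {q z : ℝ}
    (hq : HasSum (fun n : ℕ => 1 / ((n : ℝ) + 1) ^ 2) q)
    (hz : HasSum (fun n : ℕ => 1 / ((n : ℝ) + 1) ^ 3) z) :
    HasSum (fun m : ℕ => (harmonic (2 * (m + 1)) : ℝ) * zetaTwoDefect q m)
      (Real.log 2 - 7 / 8 * z - 1) := by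
  -- The terms are nonpositive; after negation, convergence of the partial sums suffices for
  -- `HasSum`.
  rw [← neg_neg (Real.log 2 - 7 / 8 * z - 1)]
  refine HasSum.congr_fun (HasSum.neg (f := fun m : ℕ =>
    -((harmonic (2 * (m + 1)) : ℝ) * zetaTwoDefect q m)) ?_) fun m => (neg_neg _).symm
  rw [hasSum_iff_tendsto_nat_of_nonneg (fun m => neg_nonneg.2
    (mul_nonpos_of_nonneg_of_nonpos (harmonic_nonneg_real _) (zetaTwoDefect_nonpos hq m)))]
  simp only [sum_neg_distrib]
  refine Tendsto.neg ?_
  simp only [sum_harmonic_mul_zetaTwoDefect]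
  have hv : Tendsto (fun n : ℕ => 1 / ((n : ℝ) + 1)) atTop (𝓝 0) :=
    tendsto_one_div_add_atTop_nhds_zero_nat
  have hE := (hasSum_oddHarmonic_div_sq hz).tendsto_sum_nat
  have := (((((((tendsto_mul_zetaTwoDefect hq).sub_const 1).add tendsto_harmonic_two_mul_sub).sub
    (hE.div_const 2)).add tendsto_harmonic_two_mul_div).add (hv.pow 2)).sub
    (tendsto_oddHarmonic_div.div_const 2)).sub ((tendsto_oddHarmonic_div.mul hv).div_const 2)
  convert this using 2
  · field_simp
  · ring

theorem hasSum_one_div_succ_pow {k : ℕ} (hk : 1 < k) :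
    ∃ x : ℝ, HasSum (fun n : ℕ => 1 / ((n : ℝ) + 1) ^ k) x ∧ riemannZeta k = x := by
  have hs : Summable fun n : ℕ => 1 / ((n : ℝ) + 1) ^ k := by
    have := (summable_nat_add_iff 1).2 (Real.summable_one_div_nat_pow.2 hk)
    simpa using this
  refine ⟨_, hs.hasSum, ?_⟩
  rw [zeta_eq_tsum_one_div_nat_add_one_cpow (by simpa using hk), Complex.ofReal_tsum]
  simp

theorem mainTheorem1 :
    HasSum
      (fun m : ℕ =>
        -- the term with index `n = m + 1`, so that the series runs over `n ≥ 1`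
        ((harmonic (2 * (m + 1)) : ℚ) : ℂ) *
          (riemannZeta 2 - ∑ k ∈ Finset.Icc 1 (m + 1), 1 / (k : ℂ) ^ 2 - 1 / ((m + 1 : ℕ) : ℂ)))
      ((Real.log 2 : ℂ) - 7 / 8 * riemannZeta 3 - 1) := by
  obtain ⟨q, hq, hq'⟩ := hasSum_one_div_succ_pow (k := 2) (by norm_num)
  obtain ⟨z, hz, hz'⟩ := hasSum_one_div_succ_pow (k := 3) (by norm_num)
  have h := Complex.hasSum_ofReal.2 (hasSum_harmonic_mul_zetaTwoDefect hq hz)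
  push_cast at hq' hz'
  rw [hq', hz']
  convert h using 1
  · funext m
    have : ∑ k ∈ Finset.Icc 1 (m + 1), 1 / (k : ℂ) ^ 2 =
        ∑ k ∈ range (m + 1), 1 / ((k : ℂ) + 1) ^ 2 := by
      rw [range_eq_Ico]
      have := sum_Ico_add' (fun k : ℕ => 1 / (k : ℂ) ^ 2) 0 (m + 1) 1
      push_cast at this
      exact this.symm
    rw [this, zetaTwoDefect]
    push_cast
    rfl
  · push_cast
    rfl
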